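/- Call a set $S\subset\mathbb{R}^2$ a polygonal shape if it is compact and its boundary is a union of finitely many (possibly degenerate) closed line segments; for example, $S$ may be a finite union of polygons, possibly with holes. For $x\in\mathbb{R}^2$ let $c(x,S)$ denote any point of $S$ at minimum Euclidean distance from $x$. For polygonal shapes $A,B$ and $\alpha\in[0,1]$, the Voronoi morph is $$T_\alpha=T_\alpha(A,B)=\{a+\alpha(c(a,B)-a)\mid a\in A\}\cup\{b+(1-\alpha)(c(b,A)-b)\mid b\in B\},$$ where, if a point has several closest points on the other shape, all of them are included. Let $|T_\alpha|$ denote the number (cardinality of the set) of connected components of $T_\alpha$. Let $A$ and $B$ be polygonal shapes and let $0<\alpha<\beta<1$. Then $|T_\alpha|=|T_\beta|$. -/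

import Mathlib

/-- The Euclidean plane. -/
abbrev Plane : Type := EuclideanSpace ℝ (Fin 2)

/-- A polygonal shape: a compact planar set whose topological boundary is the union of finitely many
(possibly degenerate) closed line segments. This covers finite collections of polygons, with or
without holes. -/
def IsPolygonalShape (S : Set Plane) : Prop :=
  IsCompact S ∧
    ∃ E : Finset (Plane × Plane), frontier S = ⋃ e ∈ E, segment ℝ e.1 e.2

/-- The set of all points of `S` that are closest to `x`. -/
def closestPoints (x : Plane) (S : Set Plane) : Set Plane :=
  {y | y ∈ S ∧ ∀ z ∈ S, dist x y ≤ dist x z}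

/-- The Voronoi morph of `A` and `B` at time `α`. If a point has several closest points on the
other shape, all of them are used. -/
def voronoiMorph (A B : Set Plane) (α : ℝ) : Set Plane :=
  {t | ∃ a ∈ A, ∃ c ∈ closestPoints a B, t = a + α • (c - a)} ∪
    {t | ∃ b ∈ B, ∃ c ∈ closestPoints b A, t = b + (1 - α) • (c - b)}

/-- The number of connected components of a planar set in its subspace topology, as a cardinal
(so that there is no default value when it is infinite). -/
noncomputable def numComponents (S : Set Plane) : Cardinal :=
  Cardinal.mk (ConnectedComponents S)

/-! The morph is the image of the compact set `closestPairs A B`, which does not depend on `α`,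
under `interpolate α`. For `0 < α < 1` minimality of distances makes this map injective on it
(`injOn_interpolate`). A continuous injection of a compact set into a Hausdorff space is a
homeomorphism onto its image, so all intermediate morphs are homeomorphic. -/

/-- The pairs `(a, b) ∈ A × B` in which one of the two points is closest to the other. -/
def closestPairs (A B : Set Plane) : Set (Plane × Plane) :=
  {p | p.1 ∈ A ∧ p.2 ∈ closestPoints p.1 B} ∪ {p | p.2 ∈ B ∧ p.1 ∈ closestPoints p.2 A}

/-- The point dividing the segment between the components of a pair in the ratio `α : 1 - α`. -/
def interpolate (α : ℝ) (p : Plane × Plane) : Plane := (1 - α) • p.1 + α • p.2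

theorem continuous_interpolate (α : ℝ) : Continuous (interpolate α) := by
  unfold interpolate
  fun_prop

theorem isClosed_closest_graph {A B : Set Plane} (hA : IsClosed A) (hB : IsClosed B) :
    IsClosed {p : Plane × Plane | p.1 ∈ A ∧ p.2 ∈ closestPoints p.1 B} := by
  have : {p : Plane × Plane | p.1 ∈ A ∧ p.2 ∈ closestPoints p.1 B} =
      A ×ˢ B ∩ ⋂ z ∈ B, {p | dist p.1 p.2 ≤ dist p.1 z} := by
    ext p
    simp [closestPoints, and_assoc]
  rw [this]
  exact (hA.prod hB).inter <| isClosed_biInter fun z _ =>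
    isClosed_le (continuous_fst.dist continuous_snd) (continuous_fst.dist continuous_const)

theorem isCompact_closestPairs {A B : Set Plane} (hA : IsCompact A) (hB : IsCompact B) :
    IsCompact (closestPairs A B) := by
  refine (hA.prod hB).of_isClosed_subset ?_ ?_
  · exact (isClosed_closest_graph hA.isClosed hB.isClosed).union
      ((isClosed_closest_graph hB.isClosed hA.isClosed).preimage continuous_swap)
  · rintro ⟨a, b⟩ (⟨ha, hb, -⟩ | ⟨hb, ha, -⟩) <;> exact ⟨ha, hb⟩

theorem voronoiMorph_eq_image (A B : Set Plane) (α : ℝ) :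
    voronoiMorph A B α = interpolate α '' closestPairs A B := by
  rw [closestPairs, Set.image_union, voronoiMorph]
  congr 1 <;> ext t <;> constructor
  · rintro ⟨a, ha, c, hc, rfl⟩
    exact ⟨(a, c), ⟨ha, hc⟩, by simp only [interpolate]; module⟩
  · rintro ⟨⟨a, c⟩, ⟨ha, hc⟩, rfl⟩
    exact ⟨a, ha, c, hc, by simp only [interpolate]; module⟩
  · rintro ⟨b, hb, c, hc, rfl⟩
    exact ⟨(c, b), ⟨hb, hc⟩, by simp only [interpolate]; module⟩
  · rintro ⟨⟨c, b⟩, ⟨hb, hc⟩, rfl⟩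
    exact ⟨b, hb, c, hc, by simp only [interpolate]; module⟩

/-- Two segments divided in the same ratio by a common point coincide if their endpoints form a
monotone pair of pairs. -/
theorem eq_of_interpolate_eq_of_dist_le {α : ℝ} (h0 : 0 < α) (h1 : α < 1) {a b a' b' : Plane}
    (h : interpolate α (a, b) = interpolate α (a', b'))
    (hab : dist a b ^ 2 + dist a' b' ^ 2 ≤ dist a b' ^ 2 + dist a' b ^ 2) :
    a = a' ∧ b = b' := by
  have hv : b - b' = (-((1 - α) / α)) • (a - a') := by
    have : α • (b - b') = (-(1 - α)) • (a - a') := by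
      simp only [interpolate] at h
      linear_combination (norm := module) h
    rw [← inv_smul_smul₀ h0.ne' (b - b'), this, smul_smul]
    congr 1
    ring
  -- Expanding squares turns `hab` into this inequality, while `hv` makes `b - b'` a negative
  -- multiple of `a - a'`.
  have hin : 0 ≤ inner ℝ (a - a') (b - b') := by
    simp only [dist_eq_norm, ← real_inner_self_eq_norm_sq, inner_sub_left, inner_sub_right] at hab ⊢
    linarith [real_inner_comm a b, real_inner_comm a' b, real_inner_comm a b',
      real_inner_comm a' b']
  rw [hv, inner_smul_right, real_inner_self_eq_norm_sq] at hin
  have hpos : 0 < (1 - α) / α := div_pos (by linarith) h0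
  have hz : ‖a - a'‖ = 0 := by
    by_contra hne
    have : 0 < ‖a - a'‖ ^ 2 := by positivity
    nlinarith
  have haa : a - a' = 0 := norm_eq_zero.1 hz
  exact ⟨sub_eq_zero.1 haa, sub_eq_zero.1 (by rw [hv, haa, smul_zero])⟩

/-- The mixed case: two crossing segments divided in the same ratio, neither longer than the
segment between the first endpoint of one and the second endpoint of the other. -/
theorem eq_of_interpolate_eq_of_dist_le_cross {α : ℝ} (h0 : 0 < α) (h1 : α < 1)
    {a b a' b' : Plane} (h : interpolate α (a, b) = interpolate α (a', b'))
    (hab : dist a b ≤ dist a b') (hab' : dist a' b' ≤ dist a b') :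
    a = a' ∧ b = b' := by
  have hv : a - b' = α • (a - b) + (1 - α) • (a' - b') := by
    simp only [interpolate] at h
    linear_combination (norm := module) h
  rw [dist_eq_norm, dist_eq_norm] at hab hab'
  have hu := pow_le_pow_left₀ (norm_nonneg _) hab 2
  have hu' := pow_le_pow_left₀ (norm_nonneg _) hab' 2
  -- Strict convexity of the squared norm: by `hu` and `hu'` the subtracted term must vanish.
  have hw : ‖a - b'‖ ^ 2 = α * ‖a - b‖ ^ 2 + (1 - α) * ‖a' - b'‖ ^ 2
      - α * (1 - α) * ‖(a - b) - (a' - b')‖ ^ 2 := by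
    rw [hv, norm_add_sq_real, norm_sub_sq_real (a - b), norm_smul, norm_smul, inner_smul_left,
      inner_smul_right, Real.norm_of_nonneg h0.le, Real.norm_of_nonneg (by linarith : 0 ≤ 1 - α)]
    simp only [conj_trivial]
    ring
  have hz : ‖(a - b) - (a' - b')‖ = 0 := by
    by_contra hne
    have hpos : 0 < α * (1 - α) * ‖(a - b) - (a' - b')‖ ^ 2 :=
      mul_pos (mul_pos h0 (by linarith)) (by positivity)
    have := mul_le_mul_of_nonneg_left hu h0.le
    have := mul_le_mul_of_nonneg_left hu' (by linarith : 0 ≤ 1 - α)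
    linarith
  have hd : a - b = a' - b' := sub_eq_zero.1 (norm_eq_zero.1 hz)
  have hb : b = b' := by
    rw [← hd, ← add_smul, add_sub_cancel, one_smul] at hv
    exact (sub_right_injective hv).symm
  subst hb
  exact ⟨sub_left_injective hd, rfl⟩

theorem injOn_interpolate {α : ℝ} (h0 : 0 < α) (h1 : α < 1) (A B : Set Plane) :
    Set.InjOn (interpolate α) (closestPairs A B) := by
  rintro ⟨a, b⟩ hp ⟨a', b'⟩ hp' h
  rw [Prod.mk.injEq]
  rcases hp with ⟨ha, hb, hm⟩ | ⟨hb, ha, hm⟩ <;> rcases hp' with ⟨ha', hb', hm'⟩ | ⟨hb', ha', hm'⟩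
  · refine eq_of_interpolate_eq_of_dist_le h0 h1 h ?_
    gcongr
    exacts [hm _ hb', hm' _ hb]
  -- Here `b` is closest to `a` and `a'` to `b'`, so `dist a b'` bounds both lengths.
  · exact eq_of_interpolate_eq_of_dist_le_cross h0 h1 h (hm _ hb')
      (by simpa only [dist_comm] using hm' _ ha)
  · have := eq_of_interpolate_eq_of_dist_le_cross h0 h1 h.symm (hm' _ hb)
      (by simpa only [dist_comm] using hm _ ha')
    exact ⟨this.1.symm, this.2.symm⟩
  · refine eq_of_interpolate_eq_of_dist_le h0 h1 h ?_
    rw [add_comm (dist a b' ^ 2)]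
    gcongr
    exacts [by simpa only [dist_comm] using hm _ ha', by simpa only [dist_comm] using hm' _ ha]

theorem numComponents_image_of_injOn {X : Type} [TopologicalSpace X] {K : Set X}
    (hK : IsCompact K) {f : X → Plane} (hf : Continuous f) (hinj : Set.InjOn f K) :
    numComponents (f '' K) = Cardinal.mk (ConnectedComponents K) := by
  have := isCompact_iff_compactSpace.1 hK
  let e : K ≃ₜ f '' K := Continuous.homeoOfEquivCompactToT2 (f := Equiv.Set.imageOfInjOn f K hinj)
    ((hf.comp continuous_subtype_val).subtype_mk _)
  refine (Cardinal.mk_congr (Equiv.ofBijective e.continuous.connectedComponentsMap ?_)).symm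
  refine e.isQuotientMap.isCoinducing.connectedComponentsMap_bijective fun y => ?_
  rw [← e.image_symm, Set.image_singleton]
  exact isConnected_singleton

theorem numComponents_voronoiMorph {A B : Set Plane} (hA : IsCompact A) (hB : IsCompact B)
    {α : ℝ} (h0 : 0 < α) (h1 : α < 1) :
    numComponents (voronoiMorph A B α) = Cardinal.mk (ConnectedComponents (closestPairs A B)) := by
  rw [voronoiMorph_eq_image]
  exact numComponents_image_of_injOn (isCompact_closestPairs hA hB) (continuous_interpolate α)
    (injOn_interpolate h0 h1 A B)

theorem mainTheorem3 (A B : Set Plane) (hA : IsPolygonalShape A) (hB : IsPolygonalShape B)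
    (α β : ℝ) (hα : 0 < α) (hαβ : α < β) (hβ : β < 1) :
    numComponents (voronoiMorph A B α) = numComponents (voronoiMorph A B β) := by
  rw [numComponents_voronoiMorph hA.1 hB.1 hα (hαβ.trans hβ),
    numComponents_voronoiMorph hA.1 hB.1 (hα.trans hαβ) hβ]
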